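/- Let $(R,\mathfrak m)$ be a commutative Noetherian local ring, let $M$ be a finitely generated $R$-module, let $\widehat{\ \cdot\ }$ denote $\mathfrak m$-adic completion, let $E$ be an injective hull of the residue field $R/\mathfrak m$, and let $D_R(M)=\operatorname{Hom}_R(M,E)$ be the Matlis dual of $M$. Then $$\operatorname{ir}_R(M)\;\le\;\operatorname{ir}'_R(D_R(M))\;=\;\operatorname{ir}_{\widehat R}(\widehat M).$$ Here, for a module $X$ over a commutative ring $S$, the reducibility index $\operatorname{ir}_S(X)$ is the number of submodules appearing in an irredundant decomposition $0=N_1\cap\dots\cap N_n$ of the zero submodule of $X$ into irreducible submodules (proper submodules of $X$ that are not the intersection of two strictly larger submodules), and the sum-reducibility index $\operatorname{ir}'_S(X)$ is the number of submodules appearing in an irredundant representation $X=B_1+\dots+B_n$ as a sum of sum-irreducible submodules (nonzero submodules that are not the sum of two strictly smaller submodules). In the three cases above such a decomposition or representation exists, and the number of its components does not depend on its choice, so that the three indices are well defined. (For $M=0$ the decompositions are empty, and all three indices are $0$.) -/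

import Mathlib

universe u v

/-- An `R`-linear map `i : N → E` is an injective hull of `N` if `i` is injective, `E` is an
injective `R`-module, and `E` is an essential extension of the image of `i`: every submodule of
`E` that meets the image of `i` trivially is zero. -/
structure IsInjectiveHull (R : Type u) [CommRing R] {N E : Type u}
    [AddCommGroup N] [Module R N] [AddCommGroup E] [Module R E] (i : N →ₗ[R] E) : Prop where
  injective : Function.Injective i
  injective_module : Module.Injective R E
  essential : ∀ S : Submodule R E, S ⊓ LinearMap.range i = ⊥ → S = ⊥

/-- Every module has an injective hull. -/
theorem exists_isInjectiveHull (R : Type u) [CommRing R] (N : Type u)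
    [AddCommGroup N] [Module R N] :
    ∃ (E : Type u) (_ : AddCommGroup E) (_ : Module R E) (i : N →ₗ[R] E),
      IsInjectiveHull R i := by
  let P := Classical.choice (CategoryTheory.EnoughInjectives.presentation (ModuleCat.of R N))
  obtain ⟨I, _, _, hI, f, hf⟩ : ∃ (I : Type u) (_ : AddCommGroup I) (_ : Module R I)
      (_ : Module.Injective R I) (f : N →ₗ[R] I), Function.Injective f := by
    refine ⟨P.J, inferInstance, inferInstance, ?_, P.f.hom, ?_⟩
    · have : CategoryTheory.Injective (ModuleCat.of R P.J) := P.injective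
      exact Module.injective_module_of_injective_object R P.J
    · exact (ModuleCat.mono_iff_injective P.f).1 P.mono
  -- a maximal essential extension of the image of `f` inside `I`
  let Z : Set (Submodule R I) :=
    {S | LinearMap.range f ≤ S ∧ ∀ T ≤ S, T ⊓ LinearMap.range f = ⊥ → T = ⊥}
  have hr : LinearMap.range f ∈ Z := ⟨le_rfl, fun T hT h => by rwa [inf_eq_left.2 hT] at h⟩
  obtain ⟨S, hfS, hS⟩ := zorn_le_nonempty₀ Z (fun c hc hch y hy => by
    refine ⟨sSup c, ⟨(hc hy).1.trans (le_sSup hy), fun T hT h => ?_⟩, fun z hz => le_sSup hz⟩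
    rw [Submodule.eq_bot_iff]
    intro x hx
    obtain ⟨C, hCc, hxC⟩ := (Submodule.mem_sSup_of_directed ⟨y, hy⟩ hch.directedOn).1 (hT hx)
    have h0 := (hc hCc).2 (R ∙ x) ((Submodule.span_singleton_le_iff_mem _ _).2 hxC)
      (eq_bot_iff.2 ((inf_le_inf_right _ ((Submodule.span_singleton_le_iff_mem _ _).2 hx)).trans
        h.le))
    exact Submodule.span_singleton_eq_bot.1 h0) _ hr
  -- a maximal submodule meeting `S` trivially
  obtain ⟨T, -, hT⟩ := zorn_le_nonempty₀ {T : Submodule R I | T ⊓ S = ⊥} (fun c hc hch y hy => by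
    refine ⟨sSup c, ?_, fun z hz => le_sSup hz⟩
    change sSup c ⊓ S = ⊥
    rw [Submodule.eq_bot_iff]
    rintro x ⟨hx, hxS⟩
    obtain ⟨C, hCc, hxC⟩ := (Submodule.mem_sSup_of_directed ⟨y, hy⟩ hch.directedOn).1 hx
    have h0 : C ⊓ S = ⊥ := hc hCc
    exact (Submodule.eq_bot_iff _).1 h0 x ⟨hxC, hxS⟩) ⊥ (by simp)
  have hTS : T ⊓ S = ⊥ := hT.prop
  let g : S →ₗ[R] I ⧸ T := T.mkQ ∘ₗ S.subtype
  have hg : Function.Injective g := by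
    rw [← LinearMap.ker_eq_bot, Submodule.eq_bot_iff]
    intro x hx
    have hxT : (x : I) ∈ T := by simpa [g] using hx
    exact Subtype.ext ((Submodule.eq_bot_iff _).1 hTS x ⟨hxT, x.2⟩)
  obtain ⟨h, hh⟩ := Module.Injective.out g hg S.subtype
  have hker : ∀ K : Submodule R (I ⧸ T), K ⊓ LinearMap.range g = ⊥ → K = ⊥ := by
    intro K hK
    have h1 : K.comap T.mkQ ⊓ S = ⊥ := by
      rw [Submodule.eq_bot_iff]
      rintro x ⟨hx, hxS⟩
      have h2 : g ⟨x, hxS⟩ = 0 := (Submodule.eq_bot_iff _).1 hK _ ⟨hx, ⟨⟨x, hxS⟩, rfl⟩⟩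
      have h3 := hg (h2.trans (map_zero g).symm)
      exact congrArg Subtype.val h3
    have h2 : K.comap T.mkQ ≤ T := hT.le_of_ge h1 (fun x hx => by
      have : T.mkQ x = 0 := by simpa using hx
      simp [Submodule.mem_comap, (Submodule.Quotient.mk_eq_zero T).2 hx])
    rw [Submodule.eq_bot_iff]
    intro y hy
    obtain ⟨x, rfl⟩ := T.mkQ_surjective y
    simpa using h2 hy
  have hhinj : LinearMap.ker h = ⊥ := by
    apply hker
    rw [Submodule.eq_bot_iff]
    rintro _ ⟨hx, ⟨s, rfl⟩⟩
    have h1 : h (g s) = 0 := hx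
    rw [hh] at h1
    have : s = 0 := Subtype.ext h1
    simp [this]
  have hSh : S ≤ LinearMap.range h := fun x hx => ⟨g ⟨x, hx⟩, hh ⟨x, hx⟩⟩
  have hrange : LinearMap.range h ≤ S := by
    refine hS.le_of_ge ⟨hfS.trans hSh, fun K hK hKf => ?_⟩ hSh
    have h1 : K ⊓ S = ⊥ := hS.prop.2 _ inf_le_right (by
      rw [inf_assoc, inf_eq_right.2 hfS, hKf])
    have h2 : K.comap h = ⊥ := by
      apply hker
      rw [Submodule.eq_bot_iff]
      rintro _ ⟨hx, ⟨s, rfl⟩⟩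
      have hx' : h (g s) ∈ K := hx
      rw [hh] at hx'
      have : s = 0 := Subtype.ext ((Submodule.eq_bot_iff _).1 h1 _ ⟨hx', s.2⟩)
      simp [this]
    rw [Submodule.eq_bot_iff]
    intro x hx
    obtain ⟨y, rfl⟩ := hK hx
    have : y = 0 := (Submodule.eq_bot_iff _).1 h2 y hx
    simp [this]
  let r : I →ₗ[R] S := (h ∘ₗ T.mkQ).codRestrict S (fun x => hrange ⟨_, rfl⟩)
  have hrs : ∀ s : S, r s = s := fun s => Subtype.ext (hh s)
  refine ⟨S, inferInstance, inferInstance, f.codRestrict S (fun x => hfS ⟨x, rfl⟩), ?_, ?_, ?_⟩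
  · exact fun a b hab => hf (congrArg Subtype.val hab)
  · refine ⟨fun X Y _ _ _ _ φ hφ ψ => ?_⟩
    obtain ⟨k, hk⟩ := Module.Injective.out φ hφ (S.subtype ∘ₗ ψ)
    exact ⟨r ∘ₗ k, fun x => by
      change r (k (φ x)) = ψ x
      rw [hk]
      exact hrs _⟩
  · intro K hK
    have h1 : K.map S.subtype = ⊥ := by
      refine hS.prop.2 _ (Submodule.map_subtype_le _ _) ?_
      rw [Submodule.eq_bot_iff]
      rintro _ ⟨⟨k, hk, rfl⟩, ⟨n, hn⟩⟩
      have : k = 0 := (Submodule.eq_bot_iff _).1 hK k ⟨hk, ⟨n, Subtype.ext hn⟩⟩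
      simp [this]
    exact Submodule.map_injective_of_injective S.injective_subtype (by rw [h1, Submodule.map_bot])

/-- `s` is an irredundant irreducible decomposition of the zero submodule of `M`: its members are
irreducible submodules of `M` (proper, and not an intersection of two strictly larger
submodules), their intersection is `0`, and no proper subfamily has intersection `0`. -/
structure IsIrredundantIrreducibleDecomposition (R : Type u) [CommRing R] (M : Type v)
    [AddCommGroup M] [Module R M] (s : Finset (Submodule R M)) : Prop where
  irreducible : ∀ N ∈ s, InfIrred N
  inf_eq : s.inf id = ⊥
  irredundant : ∀ t ⊂ s, t.inf id ≠ ⊥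

/-- `s` is an irredundant sum-irreducible representation of `A`: its members are sum-irreducible
submodules of `A` (nonzero, and not a sum of two strictly smaller submodules), their sum
is `A`, and no proper subfamily has sum `A`. -/
structure IsIrredundantSumIrreducibleRepresentation (R : Type u) [CommRing R] (A : Type v)
    [AddCommGroup A] [Module R A] (s : Finset (Submodule R A)) : Prop where
  sumIrreducible : ∀ B ∈ s, SupIrred B
  sup_eq : s.sup id = ⊤
  irredundant : ∀ t ⊂ s, t.sup id ≠ ⊤

/-- `n` is the reducibility index of `M`: the zero submodule of `M` has an irredundant irreducible
decomposition, and every such decomposition has exactly `n` components. -/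
structure IsReducibilityIndex (R : Type u) [CommRing R] (M : Type v)
    [AddCommGroup M] [Module R M] (n : ℕ) : Prop where
  exists_decomposition : ∃ s, IsIrredundantIrreducibleDecomposition R M s
  card_eq : ∀ s, IsIrredundantIrreducibleDecomposition R M s → s.card = n

/-- `n` is the sum-reducibility index of `A`: the module `A` has an irredundant sum-irreducible
representation, and every such representation has exactly `n` components. -/
structure IsSumReducibilityIndex (R : Type u) [CommRing R] (A : Type v)
    [AddCommGroup A] [Module R A] (n : ℕ) : Prop where
  exists_representation : ∃ s, IsIrredundantSumIrreducibleRepresentation R A s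
  card_eq : ∀ s, IsIrredundantSumIrreducibleRepresentation R A s → s.card = n

/-! Every functional `M → E` kills some `𝔪 ^ n M`, so it extends to the completion of `M` and gives
a pairing of the completion with the Matlis dual. Annihilators under this pairing are mutually
inverse order-reversing bijections between submodules of the completion over the completed ring and
`R`-submodules of the dual (`submoduleOrderIso`). One composite is the identity because submodules
of the completion are closed and `E` is a cogenerator, the other because finite length modules are
reflexive. Irreducible decompositions thus become sum-irreducible representations. They exist
because the completion is Noetherian, and the Kurosh–Ore theorem for modular lattices fixes their
size.

For the inequality, `N` is sent to the functionals vanishing on `N`. Injectivity of `E` turns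
intersections into sums, and the cogenerator property says that the result is everything only for `N
= 0`. An irredundant decomposition of `0` in `M` therefore gives an irredundant sum for the dual,
whose terms may still split. Refining them cannot lower the count. -/

/-! ### Kurosh–Ore theory in modular lattices -/

section Lattice

variable {L L' : Type*} [Lattice L] [BoundedOrder L] [Lattice L'] [BoundedOrder L']

/-- `s` is an irredundant decomposition of `⊥` as an infimum of inf-irreducible elements. -/
structure IsIrredundantInfIrredDecomposition (s : Finset L) : Prop where
  infIrred : ∀ a ∈ s, InfIrred a
  inf_eq : s.inf id = ⊥
  irredundant : ∀ t ⊂ s, t.inf id ≠ ⊥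

/-- A decomposition of `⊥` into inf-irreducibles contains an irredundant one. -/
theorem exists_isIrredundantInfIrredDecomposition_subset (s : Finset L)
    (hs : ∀ a ∈ s, InfIrred a) (h : s.inf id = ⊥) :
    ∃ t ⊆ s, IsIrredundantInfIrredDecomposition t := by
  induction s using Finset.strongInduction with
  | H s ih =>
    by_cases hr : ∃ t ⊂ s, t.inf id = ⊥
    · obtain ⟨t, hts, ht⟩ := hr
      obtain ⟨u, hut, hu⟩ := ih t hts (fun a ha => hs a (hts.subset ha)) ht
      exact ⟨u, hut.trans hts.subset, hu⟩
    · push Not at hr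
      exact ⟨s, subset_rfl, hs, h, hr⟩

theorem exists_isIrredundantInfIrredDecomposition [WellFoundedGT L] :
    ∃ s : Finset L, IsIrredundantInfIrredDecomposition s := by
  obtain ⟨s, hs, hirr⟩ := exists_infIrred_decomposition (⊥ : L)
  obtain ⟨t, -, ht⟩ := exists_isIrredundantInfIrredDecomposition_subset s
    (fun a ha => hirr ha) hs
  exact ⟨t, ht⟩

/-- The Kurosh–Ore exchange property. -/
theorem InfIrred.exists_inf_eq_bot [IsModularLattice L] {a c : L} (ha : InfIrred a)
    (hac : a ⊓ c = ⊥) (t : Finset L) (ht : t.inf id = ⊥) : ∃ b ∈ t, b ⊓ c = ⊥ := by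
  have hcb : ∀ b : L, ((c ⊓ b) ⊔ a) ⊓ c = c ⊓ b := fun b => by
    rw [sup_inf_assoc_of_le a (inf_le_left : c ⊓ b ≤ c), hac, sup_bot_eq]
  -- By modularity `x ↦ x ⊔ a` embeds `[⊥, c]` into `[a, c ⊔ a]`, so the elements `c ⊓ b`, with
  -- infimum `⊥`, go to elements with infimum `a`. The factor `c ⊔ a` matters only for empty `t`.
  have hta : t.inf (fun b => (c ⊓ b) ⊔ a) ⊓ (c ⊔ a) = a := by
    set z := t.inf (fun b => (c ⊓ b) ⊔ a) ⊓ (c ⊔ a) with hz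
    have haz : a ≤ z := le_inf (Finset.le_inf fun b _ => le_sup_right) le_sup_right
    have hzc : c ⊓ z = ⊥ := by
      rw [eq_bot_iff, ← ht]
      refine Finset.le_inf fun b hb => ?_
      calc c ⊓ z ≤ ((c ⊓ b) ⊔ a) ⊓ c :=
            le_inf ((inf_le_right.trans inf_le_left).trans (Finset.inf_le hb)) inf_le_left
        _ = c ⊓ b := hcb b
        _ ≤ b := inf_le_right
    calc z = (a ⊔ c) ⊓ z := (inf_eq_right.2 (inf_le_right.trans (sup_comm c a).le)).symm
      _ = a ⊔ c ⊓ z := sup_inf_assoc_of_le c haz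
      _ = a := by rw [hzc, sup_bot_eq]
  have key : ∀ b : L, (c ⊓ b) ⊔ a = a → b ⊓ c = ⊥ := fun b hb => by
    have h1 : c ⊓ b ≤ a := sup_eq_right.1 hb
    rw [eq_bot_iff, ← hac]
    exact le_inf ((inf_comm b c).le.trans h1) inf_le_right
  rcases ha.2 hta with h | h
  · obtain ⟨b, hb, hba⟩ := ha.finset_inf_eq h
    exact ⟨b, hb, key b hba⟩
  · have hc : c = ⊥ := by rw [← hac, eq_comm, inf_eq_right]; exact sup_eq_right.1 h
    obtain rfl | ⟨b, hb⟩ := t.eq_empty_or_nonempty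
    · exact absurd (le_antisymm le_top (by rw [← Finset.inf_empty (f := id), ht]; exact bot_le))
        ha.ne_top
    · exact ⟨b, hb, by rw [hc, inf_bot_eq]⟩

/-- The exchange property replaces members of `s` outside `t` by members of `t`, one at a time,
without increasing the size; once `s ⊆ t`, irredundance of `t` forces equality. The exchanged
families need not be irredundant, so none is assumed of `s`. -/
theorem IsIrredundantInfIrredDecomposition.card_le [IsModularLattice L] {t : Finset L}
    (ht : IsIrredundantInfIrredDecomposition t) (s : Finset L) (hs : ∀ a ∈ s, InfIrred a)
    (h : s.inf id = ⊥) : t.card ≤ s.card := by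
  classical
  induction hn : (s \ t).card using Nat.strong_induction_on generalizing s with
  | _ n ih =>
    by_cases hst : s ⊆ t
    · obtain rfl | hss := eq_or_ssubset_of_subset hst
      · rfl
      · exact absurd h (ht.irredundant s hss)
    · obtain ⟨a, has, hat⟩ := Finset.not_subset.1 hst
      obtain ⟨b, hbt, hb⟩ := (hs a has).exists_inf_eq_bot (c := (s.erase a).inf id)
        (by rw [← h, ← Finset.insert_erase has, Finset.inf_insert]; simp) t ht.inf_eq
      refine (ih _ ?_ (insert b (s.erase a)) ?_ ?_ rfl).trans ?_
      · rw [← hn]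
        refine Finset.card_lt_card (Finset.ssubset_iff_of_subset ?_ |>.2 ⟨a, ?_, ?_⟩)
        · intro x hx
          simp only [Finset.mem_sdiff, Finset.mem_insert, Finset.mem_erase] at hx ⊢
          obtain ⟨rfl | hx, hxt⟩ := hx
          · exact absurd hbt hxt
          · exact ⟨hx.2, hxt⟩
        · simp [has, hat]
        · simp only [Finset.mem_sdiff, Finset.mem_insert, Finset.mem_erase]
          rintro ⟨rfl | hx, -⟩
          · exact hat hbt
          · exact hx.1 rfl
      · intro x hx
        obtain rfl | hx := Finset.mem_insert.1 hx
        · exact ht.infIrred _ hbt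
        · exact hs x (Finset.mem_of_mem_erase hx)
      · rw [Finset.inf_insert]; exact hb
      · exact (Finset.card_insert_le _ _).trans (by rw [Finset.card_erase_add_one has])

/-- The Kurosh–Ore theorem: irredundant decompositions have the same number of components. -/
theorem IsIrredundantInfIrredDecomposition.card_eq [IsModularLattice L] {s t : Finset L}
    (hs : IsIrredundantInfIrredDecomposition s) (ht : IsIrredundantInfIrredDecomposition t) :
    s.card = t.card :=
  le_antisymm (hs.card_le t ht.infIrred ht.inf_eq) (ht.card_le s hs.infIrred hs.inf_eq)

/-- A map that detects which finite families have infimum `⊥` does not decrease the number of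
components of irredundant decompositions. -/
theorem exists_isIrredundantInfIrredDecomposition_card_le [WellFoundedGT L'] (g : L → L')
    (hg : ∀ u : Finset L, u.inf g = ⊥ ↔ u.inf id = ⊥) {s : Finset L} (hs : s.inf id = ⊥)
    (hirr : ∀ t ⊂ s, t.inf id ≠ ⊥) :
    ∃ t : Finset L', IsIrredundantInfIrredDecomposition t ∧ s.card ≤ t.card := by
  classical
  choose d hd hd' using fun a : L => exists_infIrred_decomposition (g a)
  obtain ⟨t, hts, ht⟩ := exists_isIrredundantInfIrredDecomposition_subset (s.biUnion d)
    (by simp only [Finset.mem_biUnion]; rintro b ⟨a, -, hb⟩; exact hd' a hb)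
    (by rw [Finset.inf_biUnion, ← (hg s).2 hs]; exact Finset.inf_congr rfl fun a _ => hd a)
  have hmem : ∀ b : t, ∃ a ∈ s, g a ≤ b := fun b => by
    obtain ⟨a, has, hb⟩ := Finset.mem_biUnion.1 (hts b.2)
    exact ⟨a, has, hd a ▸ Finset.inf_le (f := id) hb⟩
  choose f hfs hf using hmem
  refine ⟨t, ht, ?_⟩
  -- If no member of `t` were assigned to `a`, the other `g`-values would already have infimum `⊥`,
  -- making `a` redundant in `s`.
  have hsub : s ⊆ t.attach.image f := by
    by_contra hns
    obtain ⟨a, has, ha⟩ := Finset.not_subset.1 hns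
    refine hirr _ (Finset.erase_ssubset has) ((hg _).1 ?_)
    rw [eq_bot_iff, ← ht.inf_eq]
    refine Finset.le_inf fun b hb => ?_
    refine (Finset.inf_le (Finset.mem_erase.2 ⟨?_, hfs ⟨b, hb⟩⟩)).trans (hf ⟨b, hb⟩)
    rintro rfl
    exact ha (Finset.mem_image_of_mem f (Finset.mem_attach _ _))
  exact (Finset.card_le_card hsub).trans (Finset.card_image_le.trans (by simp))

theorem InfIrred.map_orderIso (e : L ≃o L') {a : L} (ha : InfIrred a) : InfIrred (e a) := by
  refine ⟨fun h => ha.1 fun b hab => ?_, fun b c h => ?_⟩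
  · exact e.le_iff_le.1 (h (e.le_iff_le.2 hab))
  · have := @ha.2 (e.symm b) (e.symm c) (by rw [← map_inf, h, e.symm_apply_apply])
    simpa only [e.symm_apply_eq] using this

theorem IsIrredundantInfIrredDecomposition.map_orderIso (e : L ≃o L') {s : Finset L}
    (hs : IsIrredundantInfIrredDecomposition s) :
    IsIrredundantInfIrredDecomposition (s.map e.toEmbedding) := by
  have hinf : ∀ t : Finset L, (t.map e.toEmbedding).inf id = e (t.inf id) := fun t => by
    rw [Finset.inf_map, map_finset_inf]; rfl
  refine ⟨?_, ?_, fun t ht h => ?_⟩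
  · intro a ha
    obtain ⟨b, hb, rfl⟩ := Finset.mem_map.1 ha
    exact (hs.infIrred b hb).map_orderIso e
  · rw [hinf, hs.inf_eq, map_bot]
  · obtain ⟨u, hu, rfl⟩ := Finset.subset_map_iff.1 ht.subset
    rw [hinf, map_eq_bot_iff] at h
    refine hs.irredundant u ⟨hu, fun hsu => ht.2 (Finset.map_subset_map.2 hsu)⟩ h

end Lattice

/-! ### Submodules of the completion are finitely generated and closed -/

namespace AdicCompletion

variable {R : Type*} [CommRing R] {I : Ideal R} {M : Type*} [AddCommGroup M] [Module R M]

theorem val_eq_of_le {m n : ℕ} (h : m ≤ n) {x y : AdicCompletion I M}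
    (hx : x.val n = y.val n) : x.val m = y.val m := by
  rw [← transitionMap_comp_eval_apply I M h x, hx, transitionMap_comp_eval_apply]

theorem val_eq_zero_of_le {m n : ℕ} (h : m ≤ n) {x : AdicCompletion I M} (hx : x.val n = 0) :
    x.val m = 0 :=
  val_eq_of_le (y := 0) h hx

/-- The kernel of the `n`-th evaluation map as a submodule over the completed ring. -/
def kerEval (I : Ideal R) (M : Type*) [AddCommGroup M] [Module R M] (n : ℕ) :
    Submodule (AdicCompletion I R) (AdicCompletion I M) where
  carrier := {x | x.val n = 0}
  add_mem' {x y} hx hy := by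
    have hx : x.val n = 0 := hx
    have hy : y.val n = 0 := hy
    simp [hx, hy]
  zero_mem' := rfl
  smul_mem' r x hx := by
    have hx : x.val n = 0 := hx
    change (r • x).val n = 0
    rw [smul_eval, hx]
    exact smul_zero _

@[simp]
theorem mem_kerEval {n : ℕ} {x : AdicCompletion I M} : x ∈ kerEval I M n ↔ x.val n = 0 := Iff.rfl

/-- As `I` is finitely generated, the kernel of the `n`-th evaluation is `I ^ n` times the
completion. -/
theorem smul_val_eq_zero [IsNoetherianRing R] {k n : ℕ} {r : R} (hr : r ∈ I ^ k)
    {x : AdicCompletion I M} (hx : x.val n = 0) : (r • x).val (k + n) = 0 := by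
  have hx' : x ∈ I ^ n • (⊤ : Submodule R (AdicCompletion I M)) := by
    rw [pow_smul_top_eq_ker_eval I.fg_of_isNoetherianRing]; exact hx
  have h : r • x ∈ I ^ (k + n) • (⊤ : Submodule R (AdicCompletion I M)) := by
    rw [pow_add, Submodule.mul_smul]
    exact Submodule.smul_mem_smul hr hx'
  rw [pow_smul_top_eq_ker_eval I.fg_of_isNoetherianRing] at h
  exact h

theorem smul_val_eq [IsNoetherianRing R] {k n : ℕ} {r : R} (hr : r ∈ I ^ k)
    {x y : AdicCompletion I M} (h : x.val n = y.val n) :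
    (r • x).val (k + n) = (r • y).val (k + n) := by
  have := smul_val_eq_zero hr (x := x - y) (n := n) (by rw [val_sub_apply, h, sub_self])
  rwa [smul_sub, val_sub_apply, sub_eq_zero] at this

theorem of_val_eq_zero_iff {n : ℕ} {y : M} :
    (of I M y).val n = 0 ↔ y ∈ (I ^ n • ⊤ : Submodule R M) :=
  Submodule.Quotient.mk_eq_zero _

variable [IsNoetherianRing R]

/-- The filtration of `M` by leading terms of elements of a submodule of the completion. -/
noncomputable def leadingFiltration (Q : Submodule (AdicCompletion I R) (AdicCompletion I M)) :
    I.Filtration M where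
  N n :=
    { carrier := {y | y ∈ (I ^ n • ⊤ : Submodule R M) ∧
        ∃ q ∈ Q, q.val (n + 1) = (of I M y).val (n + 1)}
      zero_mem' := ⟨zero_mem _, 0, zero_mem _, rfl⟩
      add_mem' := by
        rintro y z ⟨hy, q, hq, hqy⟩ ⟨hz, p, hp, hpz⟩
        exact ⟨add_mem hy hz, q + p, add_mem hq hp, by
          rw [val_add_apply, hqy, hpz, map_add, val_add_apply]⟩
      smul_mem' := by
        rintro r y ⟨hy, q, hq, hqy⟩
        exact ⟨Submodule.smul_mem _ r hy, r • q, (Q.restrictScalars R).smul_mem r hq, by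
          rw [val_smul_apply, hqy, map_smul, val_smul_apply]⟩ }
  mono n := by
    rintro y ⟨hy, -⟩
    -- An element of `I ^ (n + 1) • ⊤` vanishes at level `n + 1`, so `0 ∈ Q` is a witness.
    exact ⟨Submodule.smul_mono_left (Ideal.pow_le_pow_right n.le_succ) hy, 0, Q.zero_mem,
      (of_val_eq_zero_iff.2 hy).symm⟩
  smul_le n := by
    refine Submodule.smul_le.2 ?_
    rintro r hr y ⟨hy, q, hq, hqy⟩
    refine ⟨?_, r • q, (Q.restrictScalars R).smul_mem r hq, ?_⟩
    · rw [pow_succ', Submodule.mul_smul]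
      exact Submodule.smul_mem_smul hr hy
    · have := smul_val_eq (k := 1) (by rwa [pow_one]) hqy
      rw [map_smul]
      rwa [add_comm 1] at this

theorem mem_leadingFiltration {Q : Submodule (AdicCompletion I R) (AdicCompletion I M)} {n : ℕ}
    {y : M} : y ∈ (leadingFiltration Q).N n ↔
      y ∈ (I ^ n • ⊤ : Submodule R M) ∧ ∃ q ∈ Q, q.val (n + 1) = (of I M y).val (n + 1) := Iff.rfl

/-- This is Artin–Rees: an `I`-filtration below the `I`-adic one is stable. -/
theorem leadingFiltration_stable [Module.Finite R M]
    (Q : Submodule (AdicCompletion I R) (AdicCompletion I M)) : (leadingFiltration Q).Stable :=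
  (I.stableFiltration_stable ⊤).of_le fun _ _ hy => (mem_leadingFiltration.1 hy).1

/-- Beyond the stable index `n`, lifts to `Q` of finitely many leading terms suffice to approximate
any `z` in the closure of `Q` that vanishes at level `n`. The coefficients converge in the completed
ring, so `z` lies in the span of the lifts. This gives finite generation and closedness at once. -/
theorem exists_fg_inf_kerEval [Module.Finite R M]
    (Q : Submodule (AdicCompletion I R) (AdicCompletion I M)) :
    ∃ n : ℕ, (Q ⊓ kerEval I M n).FG ∧ ∀ z : AdicCompletion I M,
      (∀ m, ∃ q ∈ Q, q.val m = z.val m) → z.val n = 0 → z ∈ Q := by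
  suffices h : ∃ n : ℕ, ∃ P ≤ Q ⊓ kerEval I M n, P.FG ∧ ∀ z : AdicCompletion I M,
      (∀ m, ∃ q ∈ Q, q.val m = z.val m) → z.val n = 0 → z ∈ P by
    obtain ⟨n, P, hPQ, hfg, hP⟩ := h
    have hPQ' : P = Q ⊓ kerEval I M n :=
      le_antisymm hPQ fun z hz => hP z (fun m => ⟨z, hz.1, rfl⟩) hz.2
    exact ⟨n, hPQ' ▸ hfg, fun z hz hzn => (hPQ (hP z hz hzn)).1⟩
  obtain ⟨n, hn⟩ := (leadingFiltration_stable Q).exists_pow_smul_eq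
  obtain ⟨ι, _, y, hy⟩ : ∃ (ι : Type) (_ : Fintype ι) (y : ι → M),
      Submodule.span R (Set.range y) = (leadingFiltration Q).N n := by
    obtain ⟨k, y, hy⟩ := Submodule.fg_iff_exists_fin_generating_family.1
      (IsNoetherian.noetherian ((leadingFiltration Q).N n))
    exact ⟨Fin k, inferInstance, y, hy⟩
  have hyN : ∀ j, y j ∈ (leadingFiltration Q).N n := fun j =>
    hy ▸ Submodule.subset_span (Set.mem_range_self j)
  choose hyn q hq hqy using fun j => mem_leadingFiltration.1 (hyN j)
  refine ⟨n, Submodule.span _ (Set.range q), Submodule.span_le.2 (by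
      rintro _ ⟨j, rfl⟩
      exact ⟨hq j, (val_eq_of_le n.le_succ (hqy j)).trans (of_val_eq_zero_iff.2 (hyn j))⟩),
    Submodule.fg_span (Set.finite_range q), fun z hz hzn => ?_⟩
  -- one step of the approximation
  have step : ∀ (k : ℕ) (w : AdicCompletion I M), (∀ m, ∃ q ∈ Q, q.val m = w.val m) →
      w.val (n + k) = 0 → ∃ a : ι → R, (∀ j, a j ∈ I ^ k) ∧
        (w - ∑ j, a j • q j).val (n + k + 1) = 0 := by
    intro k w hw hwk
    obtain ⟨p, hp, hpw⟩ := hw (n + k + 1)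
    obtain ⟨v, hv⟩ := Submodule.Quotient.mk_surjective _ (w.val (n + k + 1))
    have hv' : (of I M v).val (n + k + 1) = w.val (n + k + 1) := hv
    have hvN : v ∈ (leadingFiltration Q).N (n + k) := mem_leadingFiltration.2
      ⟨of_val_eq_zero_iff.1 ((val_eq_of_le (Nat.le_succ _) hv').trans hwk), p, hp,
        hpw.trans hv'.symm⟩
    -- Stability puts the coefficients in `I ^ k`, and this lifts the agreement of `q j` with `y j`
    -- from level `n + 1` to level `n + k + 1` after scaling.
    rw [hn k, ← hy, Submodule.mem_ideal_smul_span_iff_exists_sum] at hvN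
    obtain ⟨a, ha, rfl⟩ := hvN
    refine ⟨a, ha, ?_⟩
    rw [val_sub_apply, ← hv', sub_eq_zero, Finsupp.sum_fintype _ _ (by simp), map_sum,
      val_sum_apply, val_sum_apply]
    refine Finset.sum_congr rfl fun j _ => ?_
    rw [map_smul]
    have := smul_val_eq (ha j) (hqy j)
    rw [show n + k + 1 = k + (n + 1) by ring]
    exact this.symm
  choose! a ha haw using step
  have clos : ∀ (w : AdicCompletion I M), (∀ m, ∃ q ∈ Q, q.val m = w.val m) →
      ∀ c : ι → R, ∀ m, ∃ p ∈ Q, p.val m = (w - ∑ j, c j • q j).val m := by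
    intro w hw c m
    obtain ⟨p, hp, hpw⟩ := hw m
    exact ⟨p - ∑ j, c j • q j, sub_mem hp (sum_mem fun j _ =>
      (Q.restrictScalars R).smul_mem _ (hq j)), by rw [val_sub_apply, hpw, val_sub_apply]⟩
  -- Partial sums of the coefficients, each correction being computed from the current remainder.
  let S : ℕ → ι → R := fun k => Nat.rec (fun _ => 0)
    (fun k s => s + a k (z - ∑ j, s j • q j)) k
  have hS : ∀ k, S (k + 1) = S k + a k (z - ∑ j, S k j • q j) := fun k => rfl
  have hzS : ∀ k, (z - ∑ j, S k j • q j).val (n + k) = 0 := by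
    intro k
    induction k with
    | zero => simpa [S] using hzn
    | succ k ih =>
      have := haw k _ (clos z hz (S k)) ih
      rw [sub_sub, ← Finset.sum_add_distrib] at this
      rw [← add_assoc]
      simpa only [hS, Pi.add_apply, add_smul] using this
  have hCauchy : ∀ j k, S k j ≡ S (k + 1) j [SMOD (I ^ k • ⊤ : Submodule R R)] := by
    intro j k
    rw [SModEq.sub_mem, hS, Pi.add_apply, sub_add_cancel_left, neg_mem_iff, smul_eq_mul,
      Ideal.mul_top]
    exact ha k _ (clos z hz (S k)) (hzS k) j
  let c : ι → AdicCompletion I R := fun j =>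
    mk I R (AdicCauchySequence.mk I R (fun k => S k j) (hCauchy j))
  have hc : z = ∑ j, c j • q j := by
    ext k
    have h1 := val_eq_zero_of_le (Nat.le_add_left k n) (hzS k)
    rw [val_sub_apply, sub_eq_zero] at h1
    rw [h1, val_sum_apply, val_sum_apply]
    refine Finset.sum_congr rfl fun j _ => ?_
    rw [smul_eval, val_smul_apply]
    rfl
  rw [hc]
  exact sum_mem fun j _ => Submodule.smul_mem _ _ (Submodule.subset_span (Set.mem_range_self j))

variable [Module.Finite R M]

/-- Every submodule of the completion of a finite module is closed. -/
theorem mem_of_forall_exists_val_eq (Q : Submodule (AdicCompletion I R) (AdicCompletion I M))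
    {z : AdicCompletion I M} (hz : ∀ m, ∃ q ∈ Q, q.val m = z.val m) : z ∈ Q := by
  obtain ⟨n, -, hP⟩ := exists_fg_inf_kerEval Q
  obtain ⟨p, hp, hpz⟩ := hz n
  have h : z - p ∈ Q := by
    refine hP _ (fun m => ?_) (by rw [val_sub_apply, hpz, sub_self])
    obtain ⟨q, hq, hqz⟩ := hz m
    exact ⟨q - p, sub_mem hq hp, by rw [val_sub_apply, hqz, val_sub_apply]⟩
  simpa using add_mem h hp

instance isNoetherian_quotient_kerEval (n : ℕ) :
    IsNoetherian (AdicCompletion I R) (AdicCompletion I M ⧸ kerEval I M n) := by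
  have : IsNoetherian R (AdicCompletion I M ⧸ kerEval I M n) := by
    let f : M →ₗ[R] AdicCompletion I M ⧸ kerEval I M n :=
      ((kerEval I M n).mkQ.restrictScalars R) ∘ₗ of I M
    refine isNoetherian_of_surjective f (LinearMap.range_eq_top.2 fun x => ?_)
    obtain ⟨x, rfl⟩ := Submodule.Quotient.mk_surjective _ x
    obtain ⟨y, hy⟩ := Submodule.Quotient.mk_surjective _ (x.val n)
    refine ⟨y, (Submodule.Quotient.eq _).2 ?_⟩
    have hy' : (of I M y).val n = x.val n := hy
    rw [mem_kerEval, val_sub_apply, hy', sub_self]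
  exact isNoetherian_of_tower R this

/-- The completion of a finite module over a Noetherian ring is a Noetherian module. -/
theorem isNoetherian : IsNoetherian (AdicCompletion I R) (AdicCompletion I M) := by
  refine ⟨fun Q => ?_⟩
  obtain ⟨n, hn, -⟩ := exists_fg_inf_kerEval Q
  exact Submodule.fg_of_fg_map_of_fg_inf_ker (kerEval I M n).mkQ (IsNoetherian.noetherian _)
    (by rwa [Submodule.ker_mkQ])

end AdicCompletion

/-! ### Matlis duality for modules of finite length -/

open IsLocalRing

namespace IsInjectiveHull

variable {R : Type u} [CommRing R] {E : Type u} [AddCommGroup E] [Module R E]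

/-- Baer's criterion frees the extension property from the universe of `E`. -/
theorem exists_extension {N : Type u} [AddCommGroup N] [Module R N] {i : N →ₗ[R] E}
    (hE : IsInjectiveHull R i) {A B : Type*} [AddCommGroup A] [Module R A]
    [AddCommGroup B] [Module R B] (f : A →ₗ[R] B) (hf : Function.Injective f) (g : A →ₗ[R] E) :
    ∃ h : B →ₗ[R] E, ∀ a, h (f a) = g a := by
  obtain ⟨h, hh⟩ := (Module.Baer.of_injective hE.injective_module).extension_property f hf g
  exact ⟨h, fun a => LinearMap.congr_fun hh a⟩

variable [IsLocalRing R] {i : ResidueField R →ₗ[R] E}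

/-- An injective hull of the residue field is a cogenerator. -/
theorem exists_apply_ne_zero (hE : IsInjectiveHull R i) {A : Type*} [AddCommGroup A] [Module R A]
    {x : A} (hx : x ≠ 0) : ∃ φ : A →ₗ[R] E, φ x ≠ 0 := by
  let f := LinearMap.toSpanSingleton R A x
  -- The annihilator of `x ≠ 0` lies in the maximal ideal, so `R x` maps onto the residue field;
  -- this map into `E` is then extended to `A`.
  have hle : LinearMap.ker f ≤ LinearMap.ker (i ∘ₗ Algebra.linearMap R (ResidueField R)) := by
    intro r hr
    have hr' : r • x = 0 := hr
    have : r ∈ maximalIdeal R := (mem_maximalIdeal r).2 fun hu => hx ((hu.smul_eq_zero).1 hr')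
    rw [LinearMap.mem_ker, LinearMap.comp_apply, Algebra.linearMap_apply,
      ResidueField.algebraMap_eq, (residue_eq_zero_iff r).2 this, map_zero]
  obtain ⟨φ, hφ⟩ := hE.exists_extension ((LinearMap.ker f).liftQ f le_rfl)
    (LinearMap.ker_eq_bot.1 (Submodule.ker_liftQ_eq_bot _ _ _ le_rfl))
    ((LinearMap.ker f).liftQ _ hle)
  refine ⟨φ, fun h0 => ?_⟩
  have h1 := hφ (Submodule.Quotient.mk 1)
  simp only [Submodule.liftQ_apply] at h1
  rw [show f 1 = x by simp [f], h0, LinearMap.comp_apply, Algebra.linearMap_apply, map_one] at h1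
  exact one_ne_zero (hE.injective (h1.symm.trans (map_zero i).symm))

/-- A submodule of `E` that does not contain the image of `1` is zero. -/
theorem eq_bot_of_notMem (hE : IsInjectiveHull R i) {S : Submodule R E} (hS : i 1 ∉ S) :
    S = ⊥ := by
  refine hE.essential S ((Submodule.eq_bot_iff _).2 ?_)
  rintro _ ⟨hc, c, rfl⟩
  by_contra h0
  have hc0 : c ≠ 0 := fun h => h0 (by rw [h, map_zero])
  obtain ⟨r, hr⟩ := residue_surjective c⁻¹
  have h1 : r • c = 1 := by
    rw [Algebra.smul_def, ResidueField.algebraMap_eq, hr, inv_mul_cancel₀ hc0]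
  exact hS (by rw [← h1, map_smul]; exact S.smul_mem r hc)

/-- By essentiality `i 1 = r • e` when `e ≠ 0`, and `r` must be a unit since the maximal ideal kills
`e`. -/
theorem mem_range_of_smul_eq_zero (hE : IsInjectiveHull R i) {e : E}
    (he : ∀ r ∈ maximalIdeal R, r • e = 0) : e ∈ LinearMap.range i := by
  by_cases h0 : e = 0
  · rw [h0]; exact zero_mem _
  · have h1 : i 1 ∈ Submodule.span R {e} := by
      by_contra h
      exact h0 (Submodule.span_singleton_eq_bot.1 (hE.eq_bot_of_notMem h))
    obtain ⟨r, hr⟩ := Submodule.mem_span_singleton.1 h1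
    have hu : IsUnit r := by
      by_contra hu
      rw [he r ((mem_maximalIdeal r).2 hu)] at hr
      exact one_ne_zero (hE.injective (hr.symm.trans (map_zero i).symm))
    obtain ⟨u, rfl⟩ := hu
    refine ⟨(↑u⁻¹ : R) • 1, ?_⟩
    rw [map_smul, ← hr, smul_smul, Units.inv_mul, one_smul]

/-- Otherwise every `𝔪 ^ n φ(A)` is nonzero and so contains `i 1`, against Krull's intersection
theorem for the finite module `φ(A)`. -/
theorem exists_pow_smul_top_le_ker [IsNoetherianRing R] (hE : IsInjectiveHull R i) {A : Type*}
    [AddCommGroup A] [Module R A] [Module.Finite R A] (φ : A →ₗ[R] E) :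
    ∃ n : ℕ, maximalIdeal R ^ n • (⊤ : Submodule R A) ≤ LinearMap.ker φ := by
  by_contra! h
  have hmem : ∀ n : ℕ, i 1 ∈ maximalIdeal R ^ n • LinearMap.range φ := fun n => by
    by_contra hn
    refine h n (LinearMap.le_ker_iff_map.2 ?_)
    rw [Submodule.map_smul'', Submodule.map_top]
    exact hE.eq_bot_of_notMem hn
  have h1 : i 1 ∈ LinearMap.range φ := by simpa using hmem 0
  have h2 : (⟨i 1, h1⟩ : LinearMap.range φ) ∈
      (⨅ n : ℕ, maximalIdeal R ^ n • ⊤ : Submodule R (LinearMap.range φ)) := by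
    refine Submodule.mem_iInf _ |>.2 fun n => ?_
    have := hmem n
    rw [← Submodule.range_subtype (LinearMap.range φ), ← Submodule.map_top,
      ← Submodule.map_smul''] at this
    obtain ⟨y, hy, hyi⟩ := this
    rwa [show (⟨i 1, h1⟩ : LinearMap.range φ) = y from Subtype.ext hyi.symm]
  rw [Ideal.iInf_pow_smul_eq_bot_of_isLocalRing _ (maximalIdeal.isMaximal R).ne_top,
    Submodule.mem_bot] at h2
  exact one_ne_zero (hE.injective ((congrArg Subtype.val h2).trans (map_zero i).symm))

/-- Evaluation at a nonzero element embeds the dual into the socle of `E`, a copy of the residue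
field. -/
theorem length_dual_le_of_isSimpleModule (hE : IsInjectiveHull R i) (S : Type*) [AddCommGroup S]
    [Module R S] [IsSimpleModule R S] : Module.length R (S →ₗ[R] E) ≤ 1 := by
  have := IsSimpleModule.nontrivial R S
  obtain ⟨s, hs⟩ := exists_ne (0 : S)
  have hm : ∀ r ∈ maximalIdeal R, r • s = 0 := by
    have : Ideal.IsMaximal (LinearMap.ker (LinearMap.toSpanSingleton R S s)) :=
      IsSimpleModule.ker_toSpanSingleton_isMaximal R hs
    intro r hr
    rw [← IsLocalRing.eq_maximalIdeal this] at hr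
    exact hr
  let f : (S →ₗ[R] E) →ₗ[R] LinearMap.range i :=
    (LinearMap.applyₗ s).codRestrict _ fun φ => hE.mem_range_of_smul_eq_zero fun r hr => by
      rw [LinearMap.applyₗ_apply_apply, ← map_smul, hm r hr, map_zero]
  have hf : Function.Injective f := by
    rw [injective_iff_map_eq_zero]
    intro φ hφ
    have h0 : φ s = 0 := congrArg Subtype.val hφ
    ext t
    obtain ⟨r, rfl⟩ := IsSimpleModule.toSpanSingleton_surjective R hs t
    simp [h0]
  refine (Module.length_le_of_injective f hf).trans ?_
  rw [← (LinearEquiv.ofInjective i hE.injective).length_eq]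
  have : IsSimpleModule R (ResidueField R) :=
    isSimpleModule_iff_isCoatom.2 (maximalIdeal.isMaximal R).out
  rw [Module.length_eq_one]

theorem length_dual_le (hE : IsInjectiveHull R i) {A : Type*} [AddCommGroup A] [Module R A]
    (hA : IsFiniteLength R A) : Module.length R (A →ₗ[R] E) ≤ Module.length R A := by
  induction hA with
  | of_subsingleton => rw [Module.length_eq_zero_iff.2 inferInstance]; exact zero_le
  | @of_simple_quotient A _ _ N _ hN ih =>
    rw [Module.length_eq_add_of_exact N.subtype N.mkQ N.injective_subtype N.mkQ_surjective
      (LinearMap.exact_subtype_mkQ N), Module.length_eq_one R (A ⧸ N)]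
    rw [Module.length_eq_add_of_exact (LinearMap.lcomp R E N.mkQ) (LinearMap.lcomp R E N.subtype)
      ?_ ?_ ?_, add_comm]
    · exact add_le_add ih (hE.length_dual_le_of_isSimpleModule _)
    · exact LinearMap.lcomp_injective_of_surjective _ N.mkQ_surjective
    · intro g
      obtain ⟨h, hh⟩ := hE.exists_extension N.subtype N.injective_subtype g
      exact ⟨h, LinearMap.ext hh⟩
    · intro g
      constructor
      · intro hg
        refine ⟨N.liftQ g fun x hx => LinearMap.congr_fun hg ⟨x, hx⟩, ?_⟩
        ext x
        rfl
      · rintro ⟨h, rfl⟩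
        ext x
        change h (N.mkQ x) = 0
        rw [Submodule.mkQ_apply, (Submodule.Quotient.mk_eq_zero N).2 x.2, map_zero]

/-- Matlis reflexivity of modules of finite length. -/
theorem exists_eq_apply_of_isFiniteLength (hE : IsInjectiveHull R i) {A : Type*} [AddCommGroup A]
    [Module R A] (hA : IsFiniteLength R A) (h : (A →ₗ[R] E) →ₗ[R] E) :
    ∃ a : A, ∀ φ : A →ₗ[R] E, h φ = φ a := by
  let ev : A →ₗ[R] (A →ₗ[R] E) →ₗ[R] E := LinearMap.applyₗ
  have hev : Function.Injective ev := by
    rw [injective_iff_map_eq_zero]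
    intro a ha
    by_contra h0
    obtain ⟨φ, hφ⟩ := hE.exists_apply_ne_zero h0
    exact hφ (LinearMap.congr_fun ha φ)
  have hfin := Module.length_ne_top_iff.2 hA
  have hD : IsFiniteLength R (A →ₗ[R] E) :=
    Module.length_ne_top_iff.1 (ne_top_of_le_ne_top hfin (hE.length_dual_le hA))
  -- The double dual is no longer than `A`, so the injective evaluation map has cokernel of length
  -- zero.
  have hle := (hE.length_dual_le hD).trans (hE.length_dual_le hA)
  rw [Module.length_eq_add_of_exact ev (LinearMap.range ev).mkQ hev
    (Submodule.mkQ_surjective _) (LinearMap.exact_map_mkQ_range ev)] at hle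
  have h0 : Module.length R (((A →ₗ[R] E) →ₗ[R] E) ⧸ LinearMap.range ev) = 0 := by
    have := (ENat.add_le_add_iff_left hfin).1 (hle.trans (add_zero _).ge)
    exact le_antisymm this zero_le
  have := Submodule.Quotient.subsingleton_iff.1 (Module.length_eq_zero_iff.1 h0)
  obtain ⟨a, ha⟩ := LinearMap.range_eq_top.1 this h
  exact ⟨a, fun φ => (LinearMap.congr_fun ha φ).symm⟩

end IsInjectiveHull

theorem IsLocalRing.isFiniteLength_quotient_pow_smul_top (R : Type*) [CommRing R] [IsLocalRing R]
    [IsNoetherianRing R] (M : Type*) [AddCommGroup M] [Module R M] [Module.Finite R M] (n : ℕ) :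
    IsFiniteLength R (M ⧸ (maximalIdeal R ^ n • ⊤ : Submodule R M)) := by
  -- For `n = 0` the quotient ring is zero, hence not local.
  obtain rfl | hn := eq_or_ne n 0
  · have : Subsingleton (M ⧸ (maximalIdeal R ^ 0 • ⊤ : Submodule R M)) := by
      rw [pow_zero, one_smul]
      exact Submodule.Quotient.subsingleton_iff.2 rfl
    exact .of_subsingleton
  have hne : maximalIdeal R ^ n ≠ ⊤ :=
    ((Ideal.pow_le_self hn).trans_lt (maximalIdeal.isMaximal R).ne_top.lt_top).ne
  have : Nontrivial (R ⧸ maximalIdeal R ^ n) := Ideal.Quotient.nontrivial_iff.2 hne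
  have : IsLocalRing (R ⧸ maximalIdeal R ^ n) :=
    .of_surjective' (Ideal.Quotient.mk _) Ideal.Quotient.mk_surjective
  have hmax : maximalIdeal (R ⧸ maximalIdeal R ^ n) ≤
      (maximalIdeal R).map (Ideal.Quotient.mk (maximalIdeal R ^ n)) := by
    intro x hx
    obtain ⟨r, rfl⟩ := Ideal.Quotient.mk_surjective x
    refine Ideal.mem_map_of_mem _ ((mem_maximalIdeal r).2 fun hr => ?_)
    exact (mem_maximalIdeal _).1 hx (hr.map _)
  have : IsArtinianRing (R ⧸ maximalIdeal R ^ n) := by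
    rw [isArtinianRing_iff_isNilpotent_maximalIdeal]
    refine ⟨n, ?_⟩
    rw [Ideal.zero_eq_bot, eq_bot_iff]
    refine (Ideal.pow_right_mono hmax n).trans ?_
    rw [← Ideal.map_pow, Ideal.map_quotient_self]
  have : Module.Finite (R ⧸ maximalIdeal R ^ n) (M ⧸ (maximalIdeal R ^ n • ⊤ : Submodule R M)) :=
    .of_restrictScalars_finite R _ _
  rw [← Module.length_ne_top_iff, Module.length_eq_of_surjective (R := R ⧸ maximalIdeal R ^ n)
    Ideal.Quotient.mk_surjective]
  exact Module.length_ne_top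

/-! ### The pairing between the completion and the dual -/

section Pairing

variable {R : Type*} [CommRing R] {I : Ideal R} {M E : Type*} [AddCommGroup M] [Module R M]
  [AddCommGroup E] [Module R E]

open Classical in
/-- The extension to the completion of a linear map that kills `I ^ n • ⊤` for some `n`. -/
noncomputable def LinearMap.extendAdicCompletion (I : Ideal R) (φ : M →ₗ[R] E) :
    AdicCompletion I M →ₗ[R] E :=
  if h : ∃ n : ℕ, I ^ n • (⊤ : Submodule R M) ≤ LinearMap.ker φ then
    (Submodule.liftQ _ φ h.choose_spec) ∘ₗ AdicCompletion.eval I M h.choose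
  else 0

/-- Makes the extension independent of the chosen exponent, by comparison at the larger of the two
levels. -/
theorem LinearMap.extendAdicCompletion_eq {φ : M →ₗ[R] E} {n : ℕ}
    (hn : I ^ n • (⊤ : Submodule R M) ≤ LinearMap.ker φ) {x : AdicCompletion I M} {y : M}
    (hy : x.val n = (AdicCompletion.of I M y).val n) : φ.extendAdicCompletion I x = φ y := by
  have h : ∃ n : ℕ, I ^ n • (⊤ : Submodule R M) ≤ LinearMap.ker φ := ⟨n, hn⟩
  rw [LinearMap.extendAdicCompletion, dif_pos h]
  obtain ⟨z, hz⟩ := Submodule.Quotient.mk_surjective _ (x.val (max n h.choose))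
  have hz' : (AdicCompletion.of I M z).val (max n h.choose) = x.val (max n h.choose) := hz
  have h1 := AdicCompletion.val_eq_of_le (le_max_left _ _) hz'
  have h2 := AdicCompletion.val_eq_of_le (le_max_right _ _) hz'
  rw [LinearMap.comp_apply, AdicCompletion.eval_apply, ← h2, ← sub_eq_zero]
  change φ z - φ y = 0
  rw [← map_sub]
  refine hn (AdicCompletion.of_val_eq_zero_iff.1 ?_)
  rw [map_sub, AdicCompletion.val_sub_apply, h1, hy, sub_self]

theorem AdicCompletion.exists_val_eq_of (x : AdicCompletion I M) (n : ℕ) :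
    ∃ y : M, x.val n = (of I M y).val n := by
  obtain ⟨z, hz⟩ := Submodule.Quotient.mk_surjective _ (x.val n)
  exact ⟨z, hz.symm⟩

theorem LinearMap.extendAdicCompletion_add {φ ψ : M →ₗ[R] E}
    (hφ : ∃ n : ℕ, I ^ n • (⊤ : Submodule R M) ≤ LinearMap.ker φ)
    (hψ : ∃ n : ℕ, I ^ n • (⊤ : Submodule R M) ≤ LinearMap.ker ψ) (x : AdicCompletion I M) :
    (φ + ψ).extendAdicCompletion I x =
      φ.extendAdicCompletion I x + ψ.extendAdicCompletion I x := by
  obtain ⟨a, ha⟩ := hφ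
  obtain ⟨b, hb⟩ := hψ
  have ha' : I ^ max a b • (⊤ : Submodule R M) ≤ LinearMap.ker φ :=
    (Submodule.smul_mono_left (Ideal.pow_le_pow_right (le_max_left _ _))).trans ha
  have hb' : I ^ max a b • (⊤ : Submodule R M) ≤ LinearMap.ker ψ :=
    (Submodule.smul_mono_left (Ideal.pow_le_pow_right (le_max_right _ _))).trans hb
  obtain ⟨y, hy⟩ := x.exists_val_eq_of (max a b)
  have hab : I ^ max a b • (⊤ : Submodule R M) ≤ LinearMap.ker (φ + ψ) := fun z hz => by
    rw [LinearMap.mem_ker, LinearMap.add_apply, ha' hz, hb' hz, add_zero]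
  rw [extendAdicCompletion_eq ha' hy, extendAdicCompletion_eq hb' hy,
    extendAdicCompletion_eq hab hy, LinearMap.add_apply]

theorem LinearMap.extendAdicCompletion_smul {φ : M →ₗ[R] E}
    (hφ : ∃ n : ℕ, I ^ n • (⊤ : Submodule R M) ≤ LinearMap.ker φ) (r : R)
    (x : AdicCompletion I M) :
    (r • φ).extendAdicCompletion I x = r • φ.extendAdicCompletion I x := by
  obtain ⟨n, hn⟩ := hφ
  obtain ⟨y, hy⟩ := x.exists_val_eq_of n
  have hn' : I ^ n • (⊤ : Submodule R M) ≤ LinearMap.ker (r • φ) := fun z hz => by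
    rw [LinearMap.mem_ker, LinearMap.smul_apply, hn hz, smul_zero]
  rw [extendAdicCompletion_eq hn hy, extendAdicCompletion_eq hn' hy, LinearMap.smul_apply]

/-- A scalar `r` congruent to `c` modulo `I ^ n` does the job. This replaces an action of the
completed ring on `E`. -/
theorem LinearMap.extendAdicCompletion_apply_smul {φ : M →ₗ[R] E}
    (hφ : ∃ n : ℕ, I ^ n • (⊤ : Submodule R M) ≤ LinearMap.ker φ) (c : AdicCompletion I R)
    (x : AdicCompletion I M) :
    ∃ r : R, φ.extendAdicCompletion I (c • x) = r • φ.extendAdicCompletion I x := by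
  obtain ⟨n, hn⟩ := hφ
  obtain ⟨y, hy⟩ := x.exists_val_eq_of n
  obtain ⟨r, hr⟩ := c.exists_val_eq_of n
  refine ⟨r, ?_⟩
  rw [extendAdicCompletion_eq hn hy, ← map_smul]
  refine extendAdicCompletion_eq hn ?_
  rw [AdicCompletion.smul_eval, hy, hr]
  rfl

end Pairing

/-! ### The anti-isomorphism of submodule lattices -/

namespace IsInjectiveHull

variable {R : Type u} [CommRing R] [IsLocalRing R] [IsNoetherianRing R]
  {E : Type u} [AddCommGroup E] [Module R E] {i : ResidueField R →ₗ[R] E}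
  {M : Type*} [AddCommGroup M] [Module R M] [Module.Finite R M]

/-- The submodule of functionals that vanish on a submodule of the completion. -/
def dualAnnihilator (hE : IsInjectiveHull R i)
    (Q : Submodule (AdicCompletion (maximalIdeal R) R) (AdicCompletion (maximalIdeal R) M)) :
    Submodule R (M →ₗ[R] E) where
  carrier := {φ | ∀ x ∈ Q, φ.extendAdicCompletion (maximalIdeal R) x = 0}
  zero_mem' x _ := by
    simpa using LinearMap.extendAdicCompletion_smul
      (hE.exists_pow_smul_top_le_ker (0 : M →ₗ[R] E)) 0 x
  add_mem' {φ ψ} hφ hψ x hx := by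
    rw [LinearMap.extendAdicCompletion_add (hE.exists_pow_smul_top_le_ker φ)
      (hE.exists_pow_smul_top_le_ker ψ), hφ x hx, hψ x hx, add_zero]
  smul_mem' r φ hφ x hx := by
    rw [LinearMap.extendAdicCompletion_smul (hE.exists_pow_smul_top_le_ker φ), hφ x hx, smul_zero]

/-- The submodule of the completion on which a submodule of functionals vanishes. -/
def dualCoannihilator (hE : IsInjectiveHull R i) (X : Submodule R (M →ₗ[R] E)) :
    Submodule (AdicCompletion (maximalIdeal R) R) (AdicCompletion (maximalIdeal R) M) where
  carrier := {x | ∀ φ ∈ X, φ.extendAdicCompletion (maximalIdeal R) x = 0}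
  zero_mem' _ _ := map_zero _
  add_mem' {x y} hx hy φ hφ := by rw [map_add, hx φ hφ, hy φ hφ, add_zero]
  smul_mem' c x hx φ hφ := by
    obtain ⟨r, hr⟩ :=
      LinearMap.extendAdicCompletion_apply_smul (hE.exists_pow_smul_top_le_ker φ) c x
    rw [hr, hx φ hφ, smul_zero]

/-- Since `Q` is closed, a point outside it is already outside its image at some level `n`, where
the cogenerator `E` separates the two. -/
theorem dualCoannihilator_dualAnnihilator (hE : IsInjectiveHull R i)
    (Q : Submodule (AdicCompletion (maximalIdeal R) R) (AdicCompletion (maximalIdeal R) M)) :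
    hE.dualCoannihilator (hE.dualAnnihilator Q) = Q := by
  refine le_antisymm (fun x hx => ?_) fun x hx φ hφ => hφ x hx
  refine AdicCompletion.mem_of_forall_exists_val_eq Q fun n => ?_
  by_contra! hn
  let P : Submodule R (M ⧸ (maximalIdeal R ^ n • ⊤ : Submodule R M)) :=
    (Q.restrictScalars R).map (AdicCompletion.eval _ M n)
  have hxP : P.mkQ (x.val n) ≠ 0 := fun h => by
    obtain ⟨q, hq, hqx⟩ := (Submodule.Quotient.mk_eq_zero P).1 h
    exact hn q hq hqx
  obtain ⟨φ, hφ⟩ := hE.exists_apply_ne_zero hxP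
  let ψ : M →ₗ[R] E := φ ∘ₗ P.mkQ ∘ₗ Submodule.mkQ _
  have hψ : maximalIdeal R ^ n • (⊤ : Submodule R M) ≤ LinearMap.ker ψ := fun y hy => by
    simp only [ψ, LinearMap.mem_ker, LinearMap.comp_apply]
    rw [Submodule.mkQ_apply (maximalIdeal R ^ n • ⊤ : Submodule R M),
      (Submodule.Quotient.mk_eq_zero _).2 hy, map_zero, map_zero]
  have hval : ∀ z, ψ.extendAdicCompletion (maximalIdeal R) z = φ (P.mkQ (z.val n)) := fun z => by
    obtain ⟨y, hy⟩ := z.exists_val_eq_of n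
    rw [LinearMap.extendAdicCompletion_eq hψ hy, hy]
    rfl
  refine hφ ((hval x).symm.trans (hx ψ fun q hq => ?_))
  have hqP : q.val n ∈ P := ⟨q, hq, rfl⟩
  rw [hval, Submodule.mkQ_apply, (Submodule.Quotient.mk_eq_zero P).2 hqP, map_zero]

/-- A map `g` on the dual modulo `X` that is nonzero at `φ ∉ X` restricts to the dual of each `M / 𝔪
^ n M`, where by reflexivity it is evaluation at some `a n`. These points assemble to a point of the
completion that annihilates `X` but not `φ`. -/
theorem dualAnnihilator_dualCoannihilator (hE : IsInjectiveHull R i)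
    (X : Submodule R (M →ₗ[R] E)) : hE.dualAnnihilator (hE.dualCoannihilator X) = X := by
  refine le_antisymm (fun φ hφ => ?_) fun φ hφ x hx => hx φ hφ
  by_contra hφX
  obtain ⟨g, hg⟩ := hE.exists_apply_ne_zero (x := X.mkQ φ)
    (fun h => hφX ((Submodule.Quotient.mk_eq_zero X).1 h))
  choose a ha using fun n : ℕ => hE.exists_eq_apply_of_isFiniteLength
    (isFiniteLength_quotient_pow_smul_top R M n)
    (g ∘ₗ X.mkQ ∘ₗ LinearMap.lcomp R E (Submodule.mkQ _))
  -- Functionals separate points, so the representing elements are unique and therefore compatible.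
  have hcompat : ∀ {m n : ℕ} (hmn : m ≤ n),
      AdicCompletion.transitionMap (maximalIdeal R) M hmn (a n) = a m := by
    intro m n hmn
    rw [← sub_eq_zero]
    by_contra h0
    obtain ⟨ψ, hψ⟩ := hE.exists_apply_ne_zero h0
    refine hψ ?_
    rw [map_sub, sub_eq_zero, ← ha m ψ]
    exact (ha n (ψ ∘ₗ AdicCompletion.transitionMap (maximalIdeal R) M hmn)).symm
  let x : AdicCompletion (maximalIdeal R) M := ⟨a, hcompat⟩
  have hx : ∀ ψ : M →ₗ[R] E, ψ.extendAdicCompletion (maximalIdeal R) x = g (X.mkQ ψ) := by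
    intro ψ
    obtain ⟨n, hn⟩ := hE.exists_pow_smul_top_le_ker ψ
    obtain ⟨y, hy⟩ := x.exists_val_eq_of n
    rw [LinearMap.extendAdicCompletion_eq hn hy]
    have h1 := ha n (Submodule.liftQ _ ψ hn)
    have hy' : a n = Submodule.Quotient.mk y := hy
    rw [hy', Submodule.liftQ_apply] at h1
    rw [← h1, LinearMap.comp_apply, LinearMap.comp_apply]
    rfl
  refine hg ((hx φ).symm.trans (hφ x fun ψ hψ => ?_))
  rw [hx, Submodule.mkQ_apply, (Submodule.Quotient.mk_eq_zero X).2 hψ, map_zero]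

/-- Matlis duality between submodules of the completion and submodules of the dual. -/
def submoduleOrderIso (hE : IsInjectiveHull R i) (M : Type*) [AddCommGroup M] [Module R M]
    [Module.Finite R M] :
    Submodule (AdicCompletion (maximalIdeal R) R) (AdicCompletion (maximalIdeal R) M) ≃o
      (Submodule R (M →ₗ[R] E))ᵒᵈ where
  toFun Q := OrderDual.toDual (hE.dualAnnihilator Q)
  invFun X := hE.dualCoannihilator (OrderDual.ofDual X)
  left_inv Q := hE.dualCoannihilator_dualAnnihilator Q
  right_inv X := congrArg OrderDual.toDual (hE.dualAnnihilator_dualCoannihilator _)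
  map_rel_iff' {P Q} := by
    refine ⟨fun h => ?_, fun h φ hφ x hx => hφ x (h hx)⟩
    rw [← hE.dualCoannihilator_dualAnnihilator P, ← hE.dualCoannihilator_dualAnnihilator Q]
    exact fun x hx φ hφ => hx φ (h hφ)

end IsInjectiveHull

/-! ### Functionals vanishing on submodules of `M` -/

section Annihilator

variable {R : Type u} [CommRing R] {E : Type u} [AddCommGroup E] [Module R E]
  {M : Type*} [AddCommGroup M] [Module R M]

theorem LinearMap.mem_ker_lcomp_subtype {N : Submodule R M} {φ : M →ₗ[R] E} :
    φ ∈ LinearMap.ker (LinearMap.lcomp R E N.subtype) ↔ ∀ x ∈ N, φ x = 0 := by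
  rw [LinearMap.mem_ker]
  exact ⟨fun h x hx => LinearMap.congr_fun h ⟨x, hx⟩, fun h => LinearMap.ext fun x => h x x.2⟩

/-- `M / (N ⊓ P)` embeds into `M / N × M / P`; a functional extended to the product splits along the
two factors. -/
theorem IsInjectiveHull.ker_lcomp_subtype_inf {A : Type u} [AddCommGroup A] [Module R A]
    {i : A →ₗ[R] E} (hE : IsInjectiveHull R i) (N P : Submodule R M) :
    LinearMap.ker (LinearMap.lcomp R E (N ⊓ P).subtype) =
      LinearMap.ker (LinearMap.lcomp R E N.subtype) ⊔
        LinearMap.ker (LinearMap.lcomp R E P.subtype) := by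
  refine le_antisymm (fun φ hφ => ?_) (sup_le (fun φ hφ => ?_) fun φ hφ => ?_)
  · rw [LinearMap.mem_ker_lcomp_subtype] at hφ
    let f : M →ₗ[R] (M ⧸ N) × (M ⧸ P) := N.mkQ.prod P.mkQ
    have hf : LinearMap.ker f = N ⊓ P := by
      rw [LinearMap.ker_prod, Submodule.ker_mkQ, Submodule.ker_mkQ]
    obtain ⟨h, hh⟩ := hE.exists_extension ((LinearMap.ker f).liftQ f le_rfl)
      (LinearMap.ker_eq_bot.1 (Submodule.ker_liftQ_eq_bot _ _ _ le_rfl))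
      ((LinearMap.ker f).liftQ φ (hf.le.trans hφ))
    refine Submodule.mem_sup.2 ⟨h ∘ₗ LinearMap.inl R _ _ ∘ₗ N.mkQ, ?_,
      h ∘ₗ LinearMap.inr R _ _ ∘ₗ P.mkQ, ?_, ?_⟩
    · refine LinearMap.mem_ker_lcomp_subtype.2 fun x hx => ?_
      simp only [LinearMap.comp_apply, Submodule.mkQ_apply,
        (Submodule.Quotient.mk_eq_zero N).2 hx, map_zero]
    · refine LinearMap.mem_ker_lcomp_subtype.2 fun x hx => ?_
      simp only [LinearMap.comp_apply, Submodule.mkQ_apply,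
        (Submodule.Quotient.mk_eq_zero P).2 hx, map_zero]
    · ext x
      have h1 : h (f x) = φ x := hh (Submodule.Quotient.mk x)
      rw [← h1]
      change h (N.mkQ x, 0) + h (0, P.mkQ x) = h (N.mkQ x, P.mkQ x)
      rw [← map_add, Prod.mk_add_mk, add_zero, zero_add]
  · rw [LinearMap.mem_ker_lcomp_subtype] at hφ ⊢
    exact fun x hx => hφ x hx.1
  · rw [LinearMap.mem_ker_lcomp_subtype] at hφ ⊢
    exact fun x hx => hφ x hx.2

theorem IsInjectiveHull.ker_lcomp_subtype_eq_top_iff [IsLocalRing R]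
    {i : IsLocalRing.ResidueField R →ₗ[R] E} (hE : IsInjectiveHull R i) (N : Submodule R M) :
    LinearMap.ker (LinearMap.lcomp R E N.subtype) = ⊤ ↔ N = ⊥ := by
  constructor
  · intro h
    rw [Submodule.eq_bot_iff]
    intro x hx
    by_contra h0
    obtain ⟨φ, hφ⟩ := hE.exists_apply_ne_zero h0
    exact hφ (LinearMap.mem_ker_lcomp_subtype.1 (h ▸ Submodule.mem_top : φ ∈ _) x hx)
  · rintro rfl
    rw [eq_top_iff]
    intro φ _
    refine LinearMap.mem_ker_lcomp_subtype.2 fun x hx => ?_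
    rw [(Submodule.mem_bot R).1 hx, map_zero]

/-- The detection hypothesis of `exists_isIrredundantInfIrredDecomposition_card_le`, with sums of
functionals read as infima in the dual order. -/
theorem IsInjectiveHull.inf_toDual_ker_lcomp_eq_bot_iff [IsLocalRing R]
    {i : IsLocalRing.ResidueField R →ₗ[R] E} (hE : IsInjectiveHull R i)
    (u : Finset (Submodule R M)) :
    u.inf (fun N => OrderDual.toDual (LinearMap.ker (LinearMap.lcomp R E N.subtype))) = ⊥ ↔
      u.inf id = ⊥ := by
  classical
  have h : u.inf (fun N => OrderDual.toDual (LinearMap.ker (LinearMap.lcomp R E N.subtype))) =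
      OrderDual.toDual (LinearMap.ker (LinearMap.lcomp R E (u.inf id).subtype)) := by
    induction u using Finset.induction_on with
    | empty =>
      rw [Finset.inf_empty, Finset.inf_empty]
      refine (congrArg OrderDual.toDual ((Submodule.eq_bot_iff _).2 fun φ hφ => ?_)).symm
      exact LinearMap.ext fun x => LinearMap.mem_ker_lcomp_subtype.1 hφ x Submodule.mem_top
    | insert N u _ ih =>
      rw [Finset.inf_insert, Finset.inf_insert, ih, id, hE.ker_lcomp_subtype_inf]
      rfl
  rw [h]
  exact hE.ker_lcomp_subtype_eq_top_iff _

end Annihilator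

/-! ### Passage to indices and conclusion -/

section Index

variable {R : Type*} [CommRing R] {M : Type*} [AddCommGroup M] [Module R M]

theorem isIrredundantIrreducibleDecomposition_iff {s : Finset (Submodule R M)} :
    IsIrredundantIrreducibleDecomposition R M s ↔ IsIrredundantInfIrredDecomposition s :=
  ⟨fun h => ⟨h.1, h.2, h.3⟩, fun h => ⟨h.1, h.2, h.3⟩⟩

theorem isIrredundantSumIrreducibleRepresentation_iff {s : Finset (Submodule R M)} :
    IsIrredundantSumIrreducibleRepresentation R M s ↔
      IsIrredundantInfIrredDecomposition (L := (Submodule R M)ᵒᵈ) s :=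
  ⟨fun h => ⟨h.1, h.2, h.3⟩, fun h => ⟨h.1, h.2, h.3⟩⟩

theorem IsIrredundantInfIrredDecomposition.isReducibilityIndex {s : Finset (Submodule R M)}
    (hs : IsIrredundantInfIrredDecomposition s) : IsReducibilityIndex R M s.card :=
  ⟨⟨s, isIrredundantIrreducibleDecomposition_iff.2 hs⟩, fun _ ht =>
    (isIrredundantIrreducibleDecomposition_iff.1 ht).card_eq hs⟩

theorem IsIrredundantInfIrredDecomposition.isSumReducibilityIndex
    {s : Finset (Submodule R M)ᵒᵈ} (hs : IsIrredundantInfIrredDecomposition s) :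
    IsSumReducibilityIndex R M s.card :=
  ⟨⟨s, isIrredundantSumIrreducibleRepresentation_iff.2 hs⟩, fun _ ht =>
    (isIrredundantSumIrreducibleRepresentation_iff.1 ht).card_eq hs⟩

end Index

theorem theorem2 (R : Type u) [CommRing R] [IsLocalRing R] [IsNoetherianRing R]
    (M : Type v) [AddCommGroup M] [Module R M] [Module.Finite R M]
    (E : Type u) [AddCommGroup E] [Module R E] (i : IsLocalRing.ResidueField R →ₗ[R] E)
    (hE : IsInjectiveHull R i) :
    ∃ a b c : ℕ,
      IsReducibilityIndex R M a ∧
      IsSumReducibilityIndex R (M →ₗ[R] E) b ∧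
      IsReducibilityIndex (AdicCompletion (IsLocalRing.maximalIdeal R) R)
        (AdicCompletion (IsLocalRing.maximalIdeal R) M) c ∧
      a ≤ b ∧ b = c := by
  have hnoeth : IsNoetherian (AdicCompletion (IsLocalRing.maximalIdeal R) R)
      (AdicCompletion (IsLocalRing.maximalIdeal R) M) := AdicCompletion.isNoetherian
  let e := hE.submoduleOrderIso M
  have hwf : WellFoundedGT (Submodule R (M →ₗ[R] E))ᵒᵈ :=
    -- The ascending chain condition on the completion becomes the descending one on the dual.
    e.symm.toOrderEmbedding.wellFoundedGT
  obtain ⟨s, hs⟩ := exists_isIrredundantInfIrredDecomposition (L := Submodule R M)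
  obtain ⟨t, ht, hst⟩ := exists_isIrredundantInfIrredDecomposition_card_le _
    hE.inf_toDual_ker_lcomp_eq_bot_iff hs.inf_eq hs.irredundant
  exact ⟨s.card, t.card, _, hs.isReducibilityIndex, ht.isSumReducibilityIndex,
    (ht.map_orderIso e.symm).isReducibilityIndex, hst, (Finset.card_map _).symm⟩
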